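/- Let $1\le k\le n$ be integers, let $\Omega=\Omega_1\times\cdots\times\Omega_n$ be a product of finite sets, let $\mu$ be a probability distribution on $\Omega$ (not necessarily of full support), and let $C>0$ be real. Let $P_{\mu,k}$ be the transition kernel of $k$-Glauber dynamics: from $x$, choose a set $S\subseteq\{1,\dots,n\}$ of size $k$ uniformly at random and resample the coordinates in $S$ from $\mu(X_S=\cdot\mid X_{S^c}=x_{S^c})$. Write $P_\mu=P_{\mu,1}$. We use the following notions. A kernel $P$ with stationary distribution $\mu$ satisfies a Poincaré inequality with constant $K$ if $\operatorname{Var}_\mu(f)\le K\langle f,(I-P)f\rangle_\mu$ for all $f:\Omega\to\mathbb R$; "$\mu$ satisfies a Poincaré inequality" means that $P_\mu$ does. A kernel $P$ satisfies $\rho$-contraction in a divergence $D$ with respect to $\mu$ if $D(\nu P\,\|\,\mu P)\le\rho\,D(\nu\,\|\,\mu)$ for all probability distributions $\nu\ll\mu$; here $D$ is $\chi^2(\nu\|\mu)=\mathbb E_\mu(\frac{\nu}{\mu}-1)^2$ or $\mathrm{KL}(\nu\|\mu)=\mathbb E_\mu\frac{\nu}{\mu}\ln\frac{\nu}{\mu}$.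 The homogenization $\mu^{\hom}$ is the image of $\mu$ under $\sigma\mapsto\{(1,\sigma_1),\dots,(n,\sigma_n)\}$, a distribution on the $n$-element subsets of $\bigsqcup_i\Omega_i$. The measure $\mu$ satisfies $C$-approximate tensorization of entropy if the kernel that removes a uniformly random element from an $n$-element subset of $\bigsqcup_i\Omega_i$ satisfies $\bigl(1-\frac1{Cn}\bigr)$-contraction in KL-divergence with respect to $\mu^{\hom}$. Finally, $\lambda_2(P)$ is the second largest eigenvalue, with multiplicity, of $P$ on $L^2(\mu)$. There are absolute constants $c,K>0$, independent of $n,k,C,\Omega,\mu$, such that $\bigl(1-\frac{k}{n+1}\bigr)^{\frac1{C+1}}\le 1-c\,\frac{k}{(C+1)n}$ and the following hold. 1. If $\mu$ satisfies a Poincaré inequality with constant $Cn$, then $$\lambda_2(P_{\mu,k})\le\Bigl(1-\frac{k}{n+1}\Bigr)^{\frac1{C+1}}$$ (if the support of $\mu$ has at least two points, so that $\lambda_2$ exists), $P_{\mu,k}$ satisfies a Poincaré inequality with constant $K\,\frac{Cn}{k}$, and $P_{\mu,k}$ satisfies $\bigl(1-c\,\frac{k}{Cn}\bigr)$-contraction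 in $\chi^2$-divergence with respect to $\mu$. 2. If $\mu$ satisfies $C$-approximate tensorization of entropy, then $P_{\mu,k}$ satisfies $\rho$-contraction in KL-divergence with respect to $\mu$, both for $\rho=\bigl(1-\frac{k}{n+1}\bigr)^{\frac1{C+1}}$ and for $\rho=1-c\,\frac{k}{Cn}$. -/

import Mathlib

open scoped Matrix

noncomputable section

namespace KGlauber

universe u v

/-! Measures on finite sets are identified with their mass functions; a probability distribution
on `A` is an element of `stdSimplex ℝ A`; a kernel from `A` to `B` is a matrix `Matrix A B ℝ`, and
the image of a measure `ν` under `P` is the row vector `ν ᵥ* P`. -/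

section Functional

variable {A : Type u} {B : Type v} [Fintype A] [Fintype B]

/-- Variance of `f` under `μ`. -/
def variance (μ : A → ℝ) (f : A → ℝ) : ℝ :=
  ∑ x, μ x * (f x - ∑ y, μ y * f y) ^ 2

/-- The Dirichlet form `⟨f, (I - P) g⟩_μ`. -/
def dirichletForm (μ : A → ℝ) (P : Matrix A A ℝ) (f g : A → ℝ) : ℝ :=
  ∑ x, μ x * (f x * (g x - (P *ᵥ g) x))

/-- `P`, with stationary distribution `μ`, satisfies a Poincaré inequality with constant `K`. -/
def Poincare (μ : A → ℝ) (P : Matrix A A ℝ) (K : ℝ) : Prop :=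
  ∀ f : A → ℝ, variance μ f ≤ K * dirichletForm μ P f f

/-- The `φ`-divergence `D_φ(ν ‖ μ) = 𝔼_{x ∼ μ} φ(ν(x)/μ(x))`, used for `ν ≪ μ`. -/
def divergence (φ : ℝ → ℝ) (ν μ : A → ℝ) : ℝ :=
  ∑ x, μ x * φ (ν x / μ x)

/-- The function that generates the `χ²`-divergence. -/
def chiSqFun (t : ℝ) : ℝ := (t - 1) ^ 2

/-- The function that generates the KL-divergence. -/
def klFun (t : ℝ) : ℝ := t * Real.log t

/-- `P` satisfies `ρ`-contraction in `φ`-divergence with respect to `μ`: for every probability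
distribution `ν ≪ μ`, `D_φ(νP ‖ μP) ≤ ρ D_φ(ν ‖ μ)`. -/
def Contracts (φ : ℝ → ℝ) (μ : A → ℝ) (P : Matrix A B ℝ) (ρ : ℝ) : Prop :=
  ∀ ν ∈ stdSimplex ℝ A, (∀ x, μ x = 0 → ν x = 0) →
    divergence φ (ν ᵥ* P) (μ ᵥ* P) ≤ ρ * divergence φ ν μ

/-- The real eigenvalues of a square matrix, with algebraic multiplicity, in decreasing order. -/
def eigenvaluesDesc [DecidableEq A] (M : Matrix A A ℝ) : List ℝ :=
  M.charpoly.roots.sort (· ≥ ·)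

/-- The transition matrix of a chain restricted to the support of `μ`. -/
def onSupport (μ : A → ℝ) (P : Matrix A A ℝ) : Matrix {x // 0 < μ x} {x // 0 < μ x} ℝ :=
  P.submatrix Subtype.val Subtype.val

/-- `λ₂(P)`: the second largest eigenvalue of the chain `P` with stationary distribution `μ`, acting
on `L²(μ)`, that is, on functions on the support of `μ`. It is used for chains that are reversible
with respect to `μ` (so that all eigenvalues are real) and whose support has at least two points;
the default value is then never taken. -/
def lambda2 [DecidableEq A] (μ : A → ℝ) (P : Matrix A A ℝ) : ℝ :=
  (eigenvaluesDesc (onSupport μ P)).getD 1 0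

end Functional

section Homogeneous

/-- The `k`-element subsets of `α`. -/
abbrev Slice (α : Type u) (k : ℕ) : Type u := {A : Finset α // A.card = k}

variable {α : Type u} [Fintype α] [DecidableEq α]

/-- The down operator from `k`-subsets to `l`-subsets. -/
def down (α : Type u) [DecidableEq α] (k l : ℕ) : Matrix (Slice α k) (Slice α l) ℝ :=
  Matrix.of fun A B => if B.1 ⊆ A.1 then 1 / (k.choose l : ℝ) else 0

/-- `C`-approximate tensorization of entropy for a measure on the `k`-subsets of `α`. -/
def ApproxTensorizationHom {k : ℕ} (μ : Slice α k → ℝ) (C : ℝ) : Prop :=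
  Contracts klFun μ (down α k (k - 1)) (1 - 1 / (C * k))

end Homogeneous

section Product

variable {n : ℕ} {Ω : Fin n → Type u} [∀ i, Fintype (Ω i)] [∀ i, DecidableEq (Ω i)]

/-- The configuration `σ` as the set `{(1, σ₁), …, (n, σₙ)}` in the disjoint union of the `Ω i`. -/
def graphSet (σ : ∀ i, Ω i) : Finset (Σ i, Ω i) :=
  Finset.univ.image fun i => ⟨i, σ i⟩

/-- The homogenization of `μ`: the image of `μ` under `graphSet`. -/
def homogenization (μ : (∀ i, Ω i) → ℝ) : Slice (Σ i, Ω i) n → ℝ :=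
  fun A => ∑ σ, if graphSet σ = A.1 then μ σ else 0

/-- `C`-approximate tensorization of entropy for a measure on a product space. -/
def ApproxTensorization (μ : (∀ i, Ω i) → ℝ) (C : ℝ) : Prop :=
  ApproxTensorizationHom (homogenization μ) C

/-- `μ(X_{Sᶜ} = x_{Sᶜ})`. -/
def marginalOff (μ : (∀ i, Ω i) → ℝ) (S : Finset (Fin n)) (x : ∀ i, Ω i) : ℝ :=
  ∑ z : ∀ i, Ω i, if ∀ i, i ∉ S → z i = x i then μ z else 0

/-- Resample the coordinates in `S` from `μ(X_S = · | X_{Sᶜ} = x_{Sᶜ})`. If the conditioning event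
is null (which is impossible for `x` in the support of `μ`), the chain stays at `x`. -/
def resample (μ : (∀ i, Ω i) → ℝ) (S : Finset (Fin n)) :
    Matrix (∀ i, Ω i) (∀ i, Ω i) ℝ :=
  Matrix.of fun x y =>
    if marginalOff μ S x = 0 then (if y = x then 1 else 0)
    else if ∀ i, i ∉ S → y i = x i then μ y / marginalOff μ S x else 0

/-- The transition kernel `P_{μ,k}` of `k`-Glauber dynamics. -/
def glauber (μ : (∀ i, Ω i) → ℝ) (k : ℕ) : Matrix (∀ i, Ω i) (∀ i, Ω i) ℝ :=
  Matrix.of fun x y =>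
    (∑ S ∈ Finset.powersetCard k (Finset.univ : Finset (Fin n)), resample μ S x y) /
      (n.choose k : ℝ)

end Product

/-- The rate `(1 - k/(n+1))^{1/(C+1)}`. -/
def rate (n k : ℕ) (C : ℝ) : ℝ :=
  (1 - (k : ℝ) / ((n : ℝ) + 1)) ^ (1 / (C + 1))

end KGlauber

end

/-! Average the entropy of `f` after resampling the coordinates in `S` over all `k`-sets `S`; by
Jensen's inequality this average bounds the entropy after one step of `k`-Glauber dynamics.
Tensorization applied to the resampled function, whose conditional entropies along `S` vanish, shows
that passing from `k` to `k + 1` multiplies the average by at most `1 - 1 / (C (n - k))`. By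
Bernoulli's inequality this factor is at most `((n - k) / (n - k + 1)) ^ (1 / (C + 1))`, and the
product of these telescopes to `(1 - k / (n + 1)) ^ (1 / (C + 1))`. The Poincaré inequality is
tensorization for `χ²`, where the average is the quadratic form of the kernel; approximate
tensorization of entropy is the case of KL. If `C < 1`, tensorization forces `μ` to be a point mass,
so the factor `1 / (C + 1)` may be replaced by a multiple of `1 / C`. -/

noncomputable section

namespace KGlauber

universe u v

open scoped BigOperators

section Entropy

variable {A : Type u} [Fintype A] {μ : A → ℝ} {φ : ℝ → ℝ} {s : Set ℝ} {f g : A → ℝ}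

/-- The `φ`-entropy of `f` under `μ`, i.e. the Jensen gap `𝔼_μ φ(f) - φ(𝔼_μ f)`. Expectations under
`μ` are written `μ ⬝ᵥ f` throughout. -/
def entropy (φ : ℝ → ℝ) (μ f : A → ℝ) : ℝ :=
  μ ⬝ᵥ (φ ∘ f) - φ (μ ⬝ᵥ f)

theorem dotProduct_congr_support (h : Set.EqOn f g (Function.support μ)) : μ ⬝ᵥ f = μ ⬝ᵥ g :=
  Finset.sum_congr rfl fun x _ => by
    by_cases hx : μ x = 0
    · simp only [hx, zero_mul]
    · rw [h hx]

theorem entropy_congr_support (φ : ℝ → ℝ) (h : Set.EqOn f g (Function.support μ)) :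
    entropy φ μ f = entropy φ μ g := by
  rw [entropy, entropy, dotProduct_congr_support h,
    dotProduct_congr_support (h.comp_left (g := φ))]

theorem dotProduct_mem (hs : Convex ℝ s) (hμ : μ ∈ stdSimplex ℝ A) (hf : ∀ x, f x ∈ s) :
    μ ⬝ᵥ f ∈ s :=
  hs.sum_mem (fun x _ => hμ.1 x) hμ.2 fun x _ => hf x

theorem map_dotProduct_le (hφ : ConvexOn ℝ s φ) (hμ : μ ∈ stdSimplex ℝ A) (hf : ∀ x, f x ∈ s) :
    φ (μ ⬝ᵥ f) ≤ μ ⬝ᵥ (φ ∘ f) :=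
  hφ.map_sum_le (fun x _ => hμ.1 x) hμ.2 fun x _ => hf x

theorem entropy_nonneg (hφ : ConvexOn ℝ s φ) (hμ : μ ∈ stdSimplex ℝ A) (hf : ∀ x, f x ∈ s) :
    0 ≤ entropy φ μ f :=
  sub_nonneg.2 (map_dotProduct_le hφ hμ hf)

theorem dotProduct_const (hμ : μ ∈ stdSimplex ℝ A) (a : ℝ) : (μ ⬝ᵥ fun _ => a) = a := by
  rw [dotProduct, ← Finset.sum_mul, hμ.2, one_mul]

theorem entropy_eq_zero_of_subsingleton_support (φ : ℝ → ℝ) (hμ : μ ∈ stdSimplex ℝ A)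
    (h : (Function.support μ).Subsingleton) (f : A → ℝ) : entropy φ μ f = 0 := by
  obtain ⟨x, -, hx⟩ : ∃ x ∈ Finset.univ, μ x ≠ 0 :=
    Finset.exists_ne_zero_of_sum_ne_zero (hμ.2.symm ▸ one_ne_zero)
  have hconst : Set.EqOn f (fun _ => f x) (Function.support μ) := fun y hy =>
    congrArg f (h hy hx)
  rw [entropy_congr_support φ hconst, entropy, dotProduct_const hμ]
  exact sub_eq_zero.2 (dotProduct_const hμ (φ (f x)))

theorem entropy_eq_zero_iff (hφ : StrictConvexOn ℝ s φ) (hμ : μ ∈ stdSimplex ℝ A)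
    (hf : ∀ x, f x ∈ s) :
    entropy φ μ f = 0 ↔ Set.EqOn f (fun _ => μ ⬝ᵥ f) (Function.support μ) := by
  rw [entropy, sub_eq_zero, eq_comm]
  have h := hφ.map_sum_eq_iff' (t := Finset.univ) (w := μ) (p := f) (fun x _ => hμ.1 x) hμ.2
    fun x _ => hf x
  simpa [dotProduct, Set.EqOn] using h

theorem divergence_mul_eq_entropy (hφ : φ 1 = 0) (hf : μ ⬝ᵥ f = 1) :
    divergence φ (μ * f) μ = entropy φ μ f := by
  rw [entropy, hf, hφ, sub_zero]
  refine dotProduct_congr_support (f := fun x => φ ((μ * f) x / μ x)) fun x hx => ?_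
  simp only [Pi.mul_apply, Function.comp_apply, mul_div_cancel_left₀ _ hx]

theorem entropy_chiSqFun (hμ : μ ∈ stdSimplex ℝ A) (f : A → ℝ) :
    entropy chiSqFun μ f = μ ⬝ᵥ (f * f) - (μ ⬝ᵥ f) ^ 2 := by
  have h : chiSqFun ∘ f = f * f - (2 : ℝ) • f + fun _ => 1 := by
    funext x
    simp only [chiSqFun, Function.comp_apply, Pi.add_apply, Pi.sub_apply, Pi.mul_apply,
      Pi.smul_apply, smul_eq_mul]
    ring
  rw [entropy, h, dotProduct_add, dotProduct_sub, dotProduct_smul, dotProduct_const hμ, chiSqFun,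
    smul_eq_mul]
  ring

theorem entropy_chiSqFun_eq_variance (hμ : μ ∈ stdSimplex ℝ A) (f : A → ℝ) :
    entropy chiSqFun μ f = variance μ f := by
  set m := μ ⬝ᵥ f with hm
  have h : variance μ f = μ ⬝ᵥ (f * f - (2 * m) • f + fun _ => m ^ 2) := by
    refine Finset.sum_congr rfl fun x _ => ?_
    simp only [Pi.add_apply, Pi.sub_apply, Pi.mul_apply, Pi.smul_apply, smul_eq_mul]
    change _ * (f x - m) ^ 2 = _
    ring
  rw [h, entropy_chiSqFun hμ, dotProduct_add, dotProduct_sub, dotProduct_smul,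
    dotProduct_const hμ, ← hm, smul_eq_mul]
  ring

theorem chiSqFun_one : chiSqFun 1 = 0 := by simp [chiSqFun]

theorem klFun_one : klFun 1 = 0 := by simp [klFun]

theorem strictConvexOn_chiSqFun : StrictConvexOn ℝ Set.univ chiSqFun := by
  have h : chiSqFun = (fun t : ℝ => t ^ 2) ∘ fun t => t + -1 := by
    funext t
    simp only [chiSqFun, Function.comp_apply, sub_eq_add_neg]
  rw [h]
  exact (even_two.strictConvexOn_pow two_ne_zero).translate_left (-1)

theorem strictConvexOn_klFun : StrictConvexOn ℝ (Set.Ici 0) klFun :=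
  Real.strictConvexOn_mul_log

theorem klFun_mul (a t : ℝ) : klFun (a * t) = a * klFun t + klFun a * t := by
  have h := Real.negMulLog_mul a t
  simp only [Real.negMulLog, klFun] at h ⊢
  linarith

theorem entropy_klFun_smul (a : ℝ) (μ f : A → ℝ) :
    entropy klFun μ (a • f) = a * entropy klFun μ f := by
  have h : klFun ∘ (a • f) = a • (klFun ∘ f) + klFun a • f := by
    funext x
    simp [klFun_mul]
  rw [entropy, entropy, h, dotProduct_add, dotProduct_smul, dotProduct_smul, dotProduct_smul,
    smul_eq_mul, smul_eq_mul, smul_eq_mul, klFun_mul]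
  ring

end Entropy

section Reversible

variable {A : Type u} [Fintype A] {μ : A → ℝ} {P : Matrix A A ℝ} {φ : ℝ → ℝ} {s : Set ℝ}
  {f g : A → ℝ}

/-- Detailed balance of the kernel `P` with respect to `μ`. -/
def IsReversible (μ : A → ℝ) (P : Matrix A A ℝ) : Prop :=
  ∀ x y, μ x * P x y = μ y * P y x

theorem dotProduct_mul (u v w : A → ℝ) : u ⬝ᵥ (v * w) = (u * v) ⬝ᵥ w := by
  simp only [dotProduct, Pi.mul_apply, mul_assoc]

theorem IsReversible.mul_vecMul (h : IsReversible μ P) (f : A → ℝ) :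
    (μ * f) ᵥ* P = μ * (P *ᵥ f) := by
  funext y
  simp only [Matrix.vecMul, Matrix.mulVec, dotProduct, Pi.mul_apply, Finset.mul_sum]
  refine Finset.sum_congr rfl fun x _ => ?_
  linear_combination f x * h x y

theorem IsReversible.dotProduct_mul_mulVec (h : IsReversible μ P) (f g : A → ℝ) :
    μ ⬝ᵥ (f * (P *ᵥ g)) = μ ⬝ᵥ ((P *ᵥ f) * g) := by
  rw [dotProduct_mul, Matrix.dotProduct_mulVec, h.mul_vecMul, ← dotProduct_mul]

variable [DecidableEq A]

theorem row_mem_stdSimplex (hP : P ∈ Matrix.rowStochastic ℝ A) (x : A) : P x ∈ stdSimplex ℝ A :=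
  ⟨fun _ => Matrix.nonneg_of_mem_rowStochastic hP, Matrix.sum_row_of_mem_rowStochastic hP x⟩

theorem mulVec_mem (hs : Convex ℝ s) (hP : P ∈ Matrix.rowStochastic ℝ A) (hf : ∀ x, f x ∈ s)
    (x : A) : (P *ᵥ f) x ∈ s :=
  dotProduct_mem hs (row_mem_stdSimplex hP x) hf

theorem IsReversible.vecMul_eq (h : IsReversible μ P) (hP : P ∈ Matrix.rowStochastic ℝ A) :
    μ ᵥ* P = μ := by
  simpa only [mul_one, Matrix.one_vecMul_of_mem_rowStochastic hP] using h.mul_vecMul 1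

theorem IsReversible.dotProduct_mulVec (h : IsReversible μ P)
    (hP : P ∈ Matrix.rowStochastic ℝ A) (f : A → ℝ) : μ ⬝ᵥ (P *ᵥ f) = μ ⬝ᵥ f := by
  rw [Matrix.dotProduct_mulVec, h.vecMul_eq hP]

theorem IsReversible.entropy_mulVec_le (h : IsReversible μ P)
    (hP : P ∈ Matrix.rowStochastic ℝ A) (hμ : ∀ x, 0 ≤ μ x) (hφ : ConvexOn ℝ s φ)
    (hf : ∀ x, f x ∈ s) : entropy φ μ (P *ᵥ f) ≤ entropy φ μ f := by
  have key : μ ⬝ᵥ (φ ∘ (P *ᵥ f)) ≤ μ ⬝ᵥ (P *ᵥ (φ ∘ f)) :=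
    dotProduct_le_dotProduct_of_nonneg_left
      (fun x => map_dotProduct_le hφ (row_mem_stdSimplex hP x) hf) hμ
  rw [h.dotProduct_mulVec hP] at key
  rw [entropy, entropy, h.dotProduct_mulVec hP]
  exact sub_le_sub_right key _

theorem IsReversible.contracts (h : IsReversible μ P) (hP : P ∈ Matrix.rowStochastic ℝ A)
    (hμ : ∀ x, 0 ≤ μ x) (hφ : φ 1 = 0) {ρ : ℝ}
    (hρ : ∀ f : A → ℝ, (∀ x, 0 ≤ f x) → entropy φ μ (P *ᵥ f) ≤ ρ * entropy φ μ f) :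
    Contracts φ μ P ρ := by
  intro ν hν hνμ
  obtain ⟨f, hf, rfl⟩ : ∃ f : A → ℝ, (∀ x, 0 ≤ f x) ∧ μ * f = ν :=
    ⟨ν / μ, fun x => div_nonneg (hν.1 x) (hμ x),
      funext fun x => mul_div_cancel_of_imp' (hνμ x)⟩
  have hmean : μ ⬝ᵥ f = 1 := hν.2
  rw [h.mul_vecMul, h.vecMul_eq hP, divergence_mul_eq_entropy hφ hmean,
    divergence_mul_eq_entropy hφ (by rw [h.dotProduct_mulVec hP, hmean])]
  exact hρ f hf

end Reversible

section Resample

variable {n : ℕ} {Ω : Fin n → Type u} [∀ i, Fintype (Ω i)] [∀ i, DecidableEq (Ω i)]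
  {μ : (∀ i, Ω i) → ℝ} {φ : ℝ → ℝ} {s : Set ℝ} {S T : Finset (Fin n)} {x y : ∀ i, Ω i}

theorem marginalOff_congr (μ : (∀ i, Ω i) → ℝ) (h : ∀ i, i ∉ S → x i = y i) :
    marginalOff μ S x = marginalOff μ S y := by
  refine Finset.sum_congr rfl fun z _ => ?_
  have : (∀ i, i ∉ S → z i = x i) ↔ ∀ i, i ∉ S → z i = y i :=
    forall₂_congr fun i hi => by rw [h i hi]
  simp only [this]

theorem marginalOff_nonneg (hμ : ∀ x, 0 ≤ μ x) (S : Finset (Fin n)) (x : ∀ i, Ω i) :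
    0 ≤ marginalOff μ S x :=
  Finset.sum_nonneg fun z _ => ite_nonneg (hμ z) le_rfl

theorem le_marginalOff (hμ : ∀ x, 0 ≤ μ x) (S : Finset (Fin n)) (x : ∀ i, Ω i) :
    μ x ≤ marginalOff μ S x := by
  have := Finset.single_le_sum (f := fun z : ∀ i, Ω i => if ∀ i, i ∉ S → z i = x i then μ z else 0)
    (fun z _ => ite_nonneg (hμ z) le_rfl) (Finset.mem_univ x)
  simpa only [marginalOff, implies_true, if_true] using this

theorem marginalOff_ne_zero (hμ : ∀ x, 0 ≤ μ x) (S : Finset (Fin n)) (hx : μ x ≠ 0) :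
    marginalOff μ S x ≠ 0 :=
  (((hμ x).lt_of_ne' hx).trans_le (le_marginalOff hμ S x)).ne'

theorem resample_apply (hμ : ∀ x, 0 ≤ μ x) (S : Finset (Fin n)) (hx : μ x ≠ 0) (y : ∀ i, Ω i) :
    resample μ S x y = if ∀ i, i ∉ S → y i = x i then μ y / marginalOff μ S x else 0 := by
  simp only [resample, Matrix.of_apply, if_neg (marginalOff_ne_zero hμ S hx)]

theorem resample_mulVec (hμ : ∀ x, 0 ≤ μ x) (S : Finset (Fin n)) (hx : μ x ≠ 0)
    (f : (∀ i, Ω i) → ℝ) :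
    (resample μ S *ᵥ f) x = marginalOff (μ * f) S x / marginalOff μ S x := by
  rw [marginalOff, Finset.sum_div, Matrix.mulVec, dotProduct]
  refine Finset.sum_congr rfl fun z _ => ?_
  simp only [resample_apply hμ S hx, ite_mul, zero_mul, div_mul_eq_mul_div, ite_div, zero_div,
    Pi.mul_apply]

theorem resample_mem_rowStochastic (hμ : ∀ x, 0 ≤ μ x) (S : Finset (Fin n)) :
    resample μ S ∈ Matrix.rowStochastic ℝ (∀ i, Ω i) := by
  refine Matrix.mem_rowStochastic_iff_sum.2 ⟨fun x y => ?_, fun x => ?_⟩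
  · exact ite_nonneg (ite_nonneg zero_le_one le_rfl)
      (ite_nonneg (div_nonneg (hμ y) (marginalOff_nonneg hμ S x)) le_rfl)
  · by_cases hx : marginalOff μ S x = 0
    · simp only [resample, Matrix.of_apply, if_pos hx, Finset.sum_ite_eq', Finset.mem_univ, if_true]
    · simp only [resample, Matrix.of_apply, if_neg hx]
      rw [← div_self hx]
      nth_rw 2 [marginalOff]
      simp only [Finset.sum_div, ite_div, zero_div]

theorem isReversible_resample (hμ : ∀ x, 0 ≤ μ x) (S : Finset (Fin n)) :
    IsReversible μ (resample μ S) := by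
  have null : ∀ x y, μ x = 0 → μ x * resample μ S x y = μ y * resample μ S y x := by
    intro x y hx
    by_cases hy : μ y = 0
    · simp only [hx, hy, zero_mul]
    · simp only [resample_apply hμ S hy, hx, zero_mul, zero_div, ite_self, mul_zero]
  intro x y
  by_cases hx : μ x = 0
  · exact null x y hx
  by_cases hy : μ y = 0
  · exact (null y x hy).symm
  rw [resample_apply hμ S hx, resample_apply hμ S hy]
  by_cases h : ∀ i, i ∉ S → y i = x i
  · rw [if_pos h, if_pos fun i hi => (h i hi).symm, marginalOff_congr μ h]
    ring
  · rw [if_neg h, if_neg fun h' => h fun i hi => (h' i hi).symm, mul_zero, mul_zero]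

theorem resample_mulVec_congr (hμ : ∀ x, 0 ≤ μ x) (hx : μ x ≠ 0) (hy : μ y ≠ 0)
    (h : ∀ i, i ∉ S → x i = y i) (f : (∀ i, Ω i) → ℝ) :
    (resample μ S *ᵥ f) x = (resample μ S *ᵥ f) y := by
  rw [resample_mulVec hμ S hx, resample_mulVec hμ S hy, marginalOff_congr _ h,
    marginalOff_congr _ h]

theorem resample_mulVec_eq_self (hμ : ∀ x, 0 ≤ μ x) (hx : μ x ≠ 0) {f : (∀ i, Ω i) → ℝ}
    (hf : ∀ z, μ z ≠ 0 → (∀ i, i ∉ S → z i = x i) → f z = f x) :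
    (resample μ S *ᵥ f) x = f x := by
  rw [resample_mulVec hμ S hx, div_eq_iff (marginalOff_ne_zero hμ S hx), marginalOff, marginalOff,
    Finset.mul_sum]
  refine Finset.sum_congr rfl fun z _ => ?_
  split_ifs with hzx
  · by_cases hz : μ z = 0
    · simp only [Pi.mul_apply, hz, zero_mul, mul_zero]
    · rw [Pi.mul_apply, hf z hz hzx, mul_comm]
  · rw [mul_zero]

theorem resample_mulVec_resample_of_subset (hμ : ∀ x, 0 ≤ μ x) (hST : S ⊆ T)
    (f : (∀ i, Ω i) → ℝ) :
    Set.EqOn (resample μ S *ᵥ (resample μ T *ᵥ f)) (resample μ T *ᵥ f) (Function.support μ) :=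
  fun _ hx => resample_mulVec_eq_self hμ hx fun _ hz h =>
    resample_mulVec_congr hμ hz hx (fun i hi => h i fun hiS => hi (hST hiS)) f

theorem resample_mulVec_resample_of_superset (hμ : ∀ x, 0 ≤ μ x) (hST : S ⊆ T)
    (f : (∀ i, Ω i) → ℝ) :
    Set.EqOn (resample μ T *ᵥ (resample μ S *ᵥ f)) (resample μ T *ᵥ f) (Function.support μ) := by
  intro x hx
  have hS := isReversible_resample hμ S
  have hT := isReversible_resample hμ T
  have duality (g : (∀ i, Ω i) → ℝ) :
      μ ⬝ᵥ (g * (resample μ T *ᵥ (resample μ S *ᵥ f))) = μ ⬝ᵥ (g * (resample μ T *ᵥ f)) := by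
    rw [hT.dotProduct_mul_mulVec, hS.dotProduct_mul_mulVec, hT.dotProduct_mul_mulVec]
    refine dotProduct_congr_support fun y hy => ?_
    rw [Pi.mul_apply, Pi.mul_apply, resample_mulVec_resample_of_subset hμ hST g hy]
  simpa [dotProduct, Pi.single_apply, Function.mem_support.1 hx] using duality (Pi.single x 1)

theorem resample_empty_mulVec (hμ : ∀ x, 0 ≤ μ x) (f : (∀ i, Ω i) → ℝ) :
    Set.EqOn (resample μ ∅ *ᵥ f) f (Function.support μ) :=
  fun _ hx => resample_mulVec_eq_self hμ hx fun _ _ h =>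
    congrArg f (funext fun i => h i (Finset.notMem_empty i))

theorem dotProduct_mul_resample_mulVec (hμ : ∀ x, 0 ≤ μ x) (S : Finset (Fin n))
    (f : (∀ i, Ω i) → ℝ) :
    μ ⬝ᵥ (f * (resample μ S *ᵥ f)) = μ ⬝ᵥ ((resample μ S *ᵥ f) * (resample μ S *ᵥ f)) := by
  rw [← (isReversible_resample hμ S).dotProduct_mul_mulVec]
  refine dotProduct_congr_support fun x hx => ?_
  rw [Pi.mul_apply, Pi.mul_apply, resample_mulVec_resample_of_subset hμ subset_rfl f hx]

theorem entropy_resample_le_of_subset (hμ : ∀ x, 0 ≤ μ x) (hφ : ConvexOn ℝ s φ)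
    {f : (∀ i, Ω i) → ℝ} (hf : ∀ x, f x ∈ s) (hST : S ⊆ T) :
    entropy φ μ (resample μ T *ᵥ f) ≤ entropy φ μ (resample μ S *ᵥ f) := by
  rw [← entropy_congr_support φ (resample_mulVec_resample_of_superset hμ hST f)]
  exact (isReversible_resample hμ T).entropy_mulVec_le (resample_mem_rowStochastic hμ T) hμ hφ
    (mulVec_mem hφ.1 (resample_mem_rowStochastic hμ S) hf)

end Resample

section Average

variable {ι : Type u} {t : Finset ι} {φ : ℝ → ℝ} {s : Set ℝ} {f : ι → ℝ}

theorem map_expect_le (hφ : ConvexOn ℝ s φ) (ht : t.Nonempty) (hf : ∀ i ∈ t, f i ∈ s) :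
    φ (𝔼 i ∈ t, f i) ≤ 𝔼 i ∈ t, φ (f i) := by
  have ht' : (t.card : ℝ) ≠ 0 := Nat.cast_ne_zero.2 ht.card_ne_zero
  have h := hφ.map_sum_le (w := fun _ => (t.card : ℝ)⁻¹) (fun _ _ => by positivity)
    (by rw [Finset.sum_const, nsmul_eq_mul, mul_inv_cancel₀ ht']) hf
  simpa only [smul_eq_mul, ← Finset.mul_sum, Finset.expect_eq_sum_div_card, div_eq_inv_mul]
    using h

theorem dotProduct_expect {A : Type v} [Fintype A] (μ : A → ℝ) (t : Finset ι) (g : ι → A → ℝ) :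
    (μ ⬝ᵥ fun x => 𝔼 i ∈ t, g i x) = 𝔼 i ∈ t, μ ⬝ᵥ g i := by
  simp only [dotProduct, Finset.mul_expect, Finset.expect_sum_comm]

variable {α : Type u} [Fintype α] [DecidableEq α] {k : ℕ}

theorem sum_powersetCard_sum_insert (k : ℕ) (F : Finset α → ℝ) :
    ∑ S ∈ Finset.powersetCard k Finset.univ, ∑ i ∈ Sᶜ, F (insert i S) =
      (k + 1) * ∑ T ∈ Finset.powersetCard (k + 1) Finset.univ, F T := by
  have h : ∀ T ∈ Finset.powersetCard (k + 1) (Finset.univ : Finset α),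
      ((k : ℝ) + 1) * F T = ∑ _i ∈ T, F T := fun T hT => by
    rw [Finset.sum_const, (Finset.mem_powersetCard.1 hT).2, nsmul_eq_mul, Nat.cast_succ]
  rw [Finset.mul_sum, Finset.sum_congr rfl h, Finset.sum_sigma', Finset.sum_sigma']
  refine Finset.sum_bij' (fun p _ => ⟨insert p.2 p.1, p.2⟩) (fun q _ => ⟨q.1.erase q.2, q.2⟩)
    ?_ ?_ ?_ ?_ fun _ _ => rfl <;>
  · intro p hp
    simp only [Finset.mem_sigma, Finset.mem_powersetCard, Finset.mem_compl] at hp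
    simp [hp]

theorem expect_powersetCard_sum_insert (hk : k < Fintype.card α) (F : Finset α → ℝ) :
    𝔼 S ∈ Finset.powersetCard k Finset.univ, ∑ i ∈ Sᶜ, F (insert i S) =
      (Fintype.card α - k) * 𝔼 T ∈ Finset.powersetCard (k + 1) Finset.univ, F T := by
  have h₀ : ((Fintype.card α).choose k : ℝ) ≠ 0 := by exact_mod_cast (Nat.choose_pos hk.le).ne'
  have h₁ : ((Fintype.card α).choose (k + 1) : ℝ) ≠ 0 := by exact_mod_cast (Nat.choose_pos hk).ne'
  have h : ((Fintype.card α).choose (k + 1) : ℝ) * (k + 1) =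
      (Fintype.card α).choose k * (Fintype.card α - k) := by
    rw [← Nat.cast_sub hk.le]
    exact_mod_cast Nat.choose_succ_right_eq (Fintype.card α) k
  rw [Finset.expect_eq_sum_div_card, Finset.expect_eq_sum_div_card, sum_powersetCard_sum_insert,
    Finset.card_powersetCard, Finset.card_powersetCard, Finset.card_univ]
  field_simp
  linear_combination (∑ T ∈ Finset.powersetCard (k + 1) Finset.univ, F T) * h

end Average

section Glauber

variable {n k : ℕ} {Ω : Fin n → Type u} [∀ i, Fintype (Ω i)] [∀ i, DecidableEq (Ω i)]
  {μ : (∀ i, Ω i) → ℝ} {φ : ℝ → ℝ} {s : Set ℝ} {f : (∀ i, Ω i) → ℝ}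

theorem powersetCard_univ_nonempty (hk : k ≤ n) :
    (Finset.powersetCard k (Finset.univ : Finset (Fin n))).Nonempty :=
  Finset.powersetCard_nonempty.2 (by simpa only [Finset.card_fin] using hk)

theorem glauber_apply (μ : (∀ i, Ω i) → ℝ) (k : ℕ) (x y : ∀ i, Ω i) :
    glauber μ k x y = 𝔼 S ∈ Finset.powersetCard k Finset.univ, resample μ S x y := by
  rw [Finset.expect_eq_sum_div_card, Finset.card_powersetCard, Finset.card_fin]
  rfl

theorem glauber_mulVec (μ : (∀ i, Ω i) → ℝ) (k : ℕ) (f : (∀ i, Ω i) → ℝ) (x : ∀ i, Ω i) :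
    (glauber μ k *ᵥ f) x =
      𝔼 S ∈ Finset.powersetCard k Finset.univ, (resample μ S *ᵥ f) x := by
  simp only [Matrix.mulVec, dotProduct, glauber_apply, Finset.expect_mul, Finset.expect_sum_comm]

theorem glauber_mem_rowStochastic (hμ : ∀ x, 0 ≤ μ x) (hk : k ≤ n) :
    glauber μ k ∈ Matrix.rowStochastic ℝ (∀ i, Ω i) := by
  refine Matrix.mem_rowStochastic_iff_sum.2 ⟨fun x y => ?_, fun x => ?_⟩
  · rw [glauber_apply]
    exact Finset.expect_nonneg fun S _ =>
      Matrix.nonneg_of_mem_rowStochastic (resample_mem_rowStochastic hμ S)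
  · simp only [glauber_apply, ← Finset.expect_sum_comm,
      Matrix.sum_row_of_mem_rowStochastic (resample_mem_rowStochastic hμ _)]
    exact Finset.expect_const (powersetCard_univ_nonempty hk) 1

theorem isReversible_glauber (hμ : ∀ x, 0 ≤ μ x) (k : ℕ) : IsReversible μ (glauber μ k) := by
  intro x y
  simp only [glauber_apply, Finset.mul_expect, isReversible_resample hμ _ x y]

/-- The average over the `k`-sets `S` of the `φ`-entropy of `f` after resampling the coordinates in
`S`. It interpolates between the entropy of `f` (`k = 0`) and `0` (`k = n`). -/
def levelEntropy (φ : ℝ → ℝ) (μ : (∀ i, Ω i) → ℝ) (k : ℕ) (f : (∀ i, Ω i) → ℝ) : ℝ :=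
  𝔼 S ∈ Finset.powersetCard k Finset.univ, entropy φ μ (resample μ S *ᵥ f)

theorem levelEntropy_zero (hμ : ∀ x, 0 ≤ μ x) (φ : ℝ → ℝ) (f : (∀ i, Ω i) → ℝ) :
    levelEntropy φ μ 0 f = entropy φ μ f := by
  rw [levelEntropy, Finset.powersetCard_zero, Finset.expect_singleton,
    entropy_congr_support φ (resample_empty_mulVec hμ f)]

theorem levelEntropy_nonneg (hφ : ConvexOn ℝ s φ) (hμ : μ ∈ stdSimplex ℝ (∀ i, Ω i))
    (hf : ∀ x, f x ∈ s) : 0 ≤ levelEntropy φ μ k f :=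
  Finset.expect_nonneg fun S _ =>
    entropy_nonneg hφ hμ (mulVec_mem hφ.1 (resample_mem_rowStochastic hμ.1 S) hf)

theorem levelEntropy_eq (hμ : ∀ x, 0 ≤ μ x) (hk : k ≤ n) :
    levelEntropy φ μ k f =
      (𝔼 S ∈ Finset.powersetCard k Finset.univ, μ ⬝ᵥ (φ ∘ (resample μ S *ᵥ f))) -
        φ (μ ⬝ᵥ f) := by
  have h (S : Finset (Fin n)) : μ ⬝ᵥ (resample μ S *ᵥ f) = μ ⬝ᵥ f :=
    (isReversible_resample hμ S).dotProduct_mulVec (resample_mem_rowStochastic hμ S) f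
  simp only [levelEntropy, entropy, h, Finset.expect_sub_distrib,
    Finset.expect_const (powersetCard_univ_nonempty hk)]

theorem entropy_glauber_mulVec_le (hφ : ConvexOn ℝ s φ) (hμ : ∀ x, 0 ≤ μ x) (hk : k ≤ n)
    (hf : ∀ x, f x ∈ s) : entropy φ μ (glauber μ k *ᵥ f) ≤ levelEntropy φ μ k f := by
  rw [levelEntropy_eq hμ hk, entropy,
    (isReversible_glauber hμ k).dotProduct_mulVec (glauber_mem_rowStochastic hμ hk)]
  refine sub_le_sub_right ?_ _
  rw [← dotProduct_expect]
  refine dotProduct_le_dotProduct_of_nonneg_left (fun x => ?_) hμ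
  rw [Function.comp_apply, glauber_mulVec]
  exact map_expect_le hφ (powersetCard_univ_nonempty hk)
    fun S _ => mulVec_mem hφ.1 (resample_mem_rowStochastic hμ S) hf x

theorem contracts_glauber (hφ : ConvexOn ℝ s φ) (hs : Set.Ici 0 ⊆ s) (hφ₁ : φ 1 = 0)
    (hμ : ∀ x, 0 ≤ μ x) (hk : k ≤ n) {ρ : ℝ}
    (hρ : ∀ f : (∀ i, Ω i) → ℝ, (∀ x, f x ∈ s) → levelEntropy φ μ k f ≤ ρ * entropy φ μ f) :
    Contracts φ μ (glauber μ k) ρ :=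
  (isReversible_glauber hμ k).contracts (glauber_mem_rowStochastic hμ hk) hμ hφ₁ fun f hf =>
    (entropy_glauber_mulVec_le hφ hμ hk fun x => hs (hf x)).trans (hρ f fun x => hs (hf x))

end Glauber

section Rate

variable {n k : ℕ} {C : ℝ}

theorem one_sub_le_rpow {l : ℝ} (hl : 0 < l) (hC : 0 < C) :
    1 - 1 / (C * l) ≤ (l / (l + 1)) ^ (1 / (C + 1)) := by
  have bernoulli : (1 + 1 / l) ^ (1 / (C + 1)) ≤ 1 + 1 / (C + 1) * (1 / l) :=
    rpow_one_add_le_one_add_mul_self (by linarith [one_div_pos.2 hl]) (by positivity)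
      ((div_le_one (by positivity)).2 (by linarith))
  have hinv : l / (l + 1) = (1 + 1 / l)⁻¹ := by field_simp
  rw [hinv, Real.inv_rpow (by positivity)]
  refine le_trans ?_ (inv_anti₀ (by positivity) bernoulli)
  have hprod : (1 - 1 / (C * l)) * (1 + 1 / (C + 1) * (1 / l)) =
      1 - (1 / (C * (C + 1) * l) + 1 / (C * (C + 1) * l ^ 2)) := by
    field_simp
    ring
  rw [← one_div, le_div_iff₀ (by positivity), hprod, sub_le_self_iff]
  positivity

theorem one_sub_div_nonneg (hk : k ≤ n) : 0 ≤ 1 - (k : ℝ) / ((n : ℝ) + 1) := by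
  have : (k : ℝ) ≤ n := by exact_mod_cast hk
  rw [sub_nonneg, div_le_one (by positivity)]
  linarith

theorem rate_zero (n : ℕ) (C : ℝ) : rate n 0 C = 1 := by simp [rate]

theorem rate_nonneg (hk : k ≤ n) (C : ℝ) : 0 ≤ rate n k C :=
  Real.rpow_nonneg (one_sub_div_nonneg hk) _

theorem rate_succ (hk : k < n) (C : ℝ) :
    rate n (k + 1) C = ((n - k : ℝ) / ((n - k : ℝ) + 1)) ^ (1 / (C + 1)) * rate n k C := by
  have hnk : (0 : ℝ) < (n : ℝ) - k := sub_pos.2 (by exact_mod_cast hk)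
  have h : 1 - ((k + 1 : ℕ) : ℝ) / ((n : ℝ) + 1) =
      ((n - k : ℝ) / ((n - k : ℝ) + 1)) * (1 - (k : ℝ) / ((n : ℝ) + 1)) := by
    have : (n : ℝ) - k + 1 ≠ 0 := by positivity
    push_cast
    field_simp
    ring
  rw [rate, rate, h, Real.mul_rpow (by positivity) (one_sub_div_nonneg hk.le)]

theorem rate_le (hk₁ : 1 ≤ k) (hk : k ≤ n) (hC : 0 ≤ C) :
    rate n k C ≤ 1 - 1 / 2 * (k / ((C + 1) * n)) := by
  have hn : (1 : ℝ) ≤ n := by exact_mod_cast hk₁.trans hk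
  have bernoulli : (1 + -((k : ℝ) / ((n : ℝ) + 1))) ^ (1 / (C + 1)) ≤
      1 + 1 / (C + 1) * -((k : ℝ) / ((n : ℝ) + 1)) :=
    rpow_one_add_le_one_add_mul_self (by linarith [one_sub_div_nonneg hk]) (by positivity)
      ((div_le_one (by positivity)).2 (by linarith))
  calc rate n k C ≤ 1 - 1 / (C + 1) * (k / ((n : ℝ) + 1)) := by
        rwa [mul_neg, ← sub_eq_add_neg, ← sub_eq_add_neg] at bernoulli
    _ ≤ 1 - 1 / (C + 1) * (k / (2 * n)) := by
        gcongr
        linarith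
    _ = 1 - 1 / 2 * (k / ((C + 1) * n)) := by field_simp

theorem rate_le_of_one_le (hk₁ : 1 ≤ k) (hk : k ≤ n) (hC : 1 ≤ C) :
    rate n k C ≤ 1 - 1 / 4 * (k / (C * n)) := by
  have hn : (1 : ℝ) ≤ n := by exact_mod_cast hk₁.trans hk
  calc rate n k C ≤ 1 - 1 / 2 * (k / ((C + 1) * n)) := rate_le hk₁ hk (by linarith)
    _ ≤ 1 - 1 / 2 * (k / ((C + C) * n)) := by gcongr
    _ = 1 - 1 / 4 * (k / (C * n)) := by
        field_simp
        ring

end Rate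

section Tensorizes

variable {n k : ℕ} {Ω : Fin n → Type u} [∀ i, Fintype (Ω i)] [∀ i, DecidableEq (Ω i)]
  {μ : (∀ i, Ω i) → ℝ} {φ : ℝ → ℝ} {s : Set ℝ} {C : ℝ} {f : (∀ i, Ω i) → ℝ}

/-- Approximate tensorization of the `φ`-entropy, for functions with values in `s`: the entropy of
`f` is at most `C` times the sum over the coordinates `i` of the average entropy of `f` conditional
on the other coordinates, which is `entropy φ μ f - entropy φ μ (resample μ {i} *ᵥ f)`. -/
def Tensorizes (φ : ℝ → ℝ) (s : Set ℝ) (μ : (∀ i, Ω i) → ℝ) (C : ℝ) : Prop :=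
  ∀ f : (∀ i, Ω i) → ℝ, (∀ x, f x ∈ s) →
    entropy φ μ f ≤ C * ∑ i, (entropy φ μ f - entropy φ μ (resample μ {i} *ᵥ f))

theorem Tensorizes.entropy_resample_le (h : Tensorizes φ s μ C) (hφ : ConvexOn ℝ s φ)
    (hμ : ∀ x, 0 ≤ μ x) (hC : 0 ≤ C) (hf : ∀ x, f x ∈ s) (S : Finset (Fin n)) :
    entropy φ μ (resample μ S *ᵥ f) ≤ C * ∑ i ∈ Sᶜ,
      (entropy φ μ (resample μ S *ᵥ f) - entropy φ μ (resample μ (insert i S) *ᵥ f)) := by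
  have hRf : ∀ x, (resample μ S *ᵥ f) x ∈ s := mulVec_mem hφ.1 (resample_mem_rowStochastic hμ S) hf
  refine (h _ hRf).trans (mul_le_mul_of_nonneg_left ?_ hC)
  have inside : ∀ i ∈ S, entropy φ μ (resample μ S *ᵥ f) -
      entropy φ μ (resample μ {i} *ᵥ (resample μ S *ᵥ f)) = 0 := fun i hi =>
    sub_eq_zero.2 (entropy_congr_support φ (resample_mulVec_resample_of_subset hμ
      (Finset.singleton_subset_iff.2 hi) f)).symm
  have outside (i : Fin n) : entropy φ μ (resample μ (insert i S) *ᵥ f) ≤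
      entropy φ μ (resample μ {i} *ᵥ (resample μ S *ᵥ f)) := by
    rw [← entropy_congr_support φ (resample_mulVec_resample_of_superset hμ
      (Finset.subset_insert i S) f)]
    exact entropy_resample_le_of_subset hμ hφ hRf
      (Finset.singleton_subset_iff.2 (Finset.mem_insert_self i S))
  rw [← Finset.sum_add_sum_compl S, Finset.sum_eq_zero inside, zero_add]
  exact Finset.sum_le_sum fun i _ => sub_le_sub_left (outside i) _

theorem Tensorizes.levelEntropy_le (h : Tensorizes φ s μ C) (hφ : ConvexOn ℝ s φ)
    (hμ : ∀ x, 0 ≤ μ x) (hC : 0 ≤ C) (hf : ∀ x, f x ∈ s) (hk : k < n) :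
    levelEntropy φ μ k f ≤
      C * ((n - k) * (levelEntropy φ μ k f - levelEntropy φ μ (k + 1) f)) := by
  have hcard : ∀ S ∈ Finset.powersetCard k (Finset.univ : Finset (Fin n)),
      (Sᶜ.card : ℝ) * entropy φ μ (resample μ S *ᵥ f) =
        (n - k) * entropy φ μ (resample μ S *ᵥ f) := fun S hS => by
    rw [Finset.card_compl, Fintype.card_fin, (Finset.mem_powersetCard.1 hS).2, Nat.cast_sub hk.le]
  calc levelEntropy φ μ k f
      ≤ 𝔼 S ∈ Finset.powersetCard k Finset.univ, C * ∑ i ∈ Sᶜ,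
          (entropy φ μ (resample μ S *ᵥ f) - entropy φ μ (resample μ (insert i S) *ᵥ f)) :=
        Finset.expect_le_expect fun S _ => h.entropy_resample_le hφ hμ hC hf S
    _ = C * ((n - k) * (levelEntropy φ μ k f - levelEntropy φ μ (k + 1) f)) := by
        simp only [← Finset.mul_expect, Finset.sum_sub_distrib, Finset.sum_const, nsmul_eq_mul,
          Finset.expect_sub_distrib]
        rw [Finset.expect_congr rfl hcard, ← Finset.mul_expect,
          expect_powersetCard_sum_insert (by rwa [Fintype.card_fin])
            fun S => entropy φ μ (resample μ S *ᵥ f), Fintype.card_fin, ← mul_sub]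
        rfl

theorem Tensorizes.levelEntropy_succ_le (h : Tensorizes φ s μ C) (hφ : ConvexOn ℝ s φ)
    (hμ : ∀ x, 0 ≤ μ x) (hC : 0 < C) (hf : ∀ x, f x ∈ s) (hk : k < n) :
    levelEntropy φ μ (k + 1) f ≤ (1 - 1 / (C * (n - k))) * levelEntropy φ μ k f := by
  have hnk : (0 : ℝ) < (n : ℝ) - k := sub_pos.2 (by exact_mod_cast hk)
  have hle := h.levelEntropy_le hφ hμ hC.le hf hk
  rw [← mul_assoc, ← div_le_iff₀' (by positivity)] at hle
  rw [sub_mul, one_mul, one_div_mul_eq_div]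
  linarith

theorem Tensorizes.levelEntropy_le_rate (h : Tensorizes φ s μ C) (hφ : ConvexOn ℝ s φ)
    (hμ : μ ∈ stdSimplex ℝ (∀ i, Ω i)) (hC : 0 < C) (hf : ∀ x, f x ∈ s) (hk : k ≤ n) :
    levelEntropy φ μ k f ≤ rate n k C * entropy φ μ f := by
  induction k with
  | zero => rw [levelEntropy_zero hμ.1, rate_zero, one_mul]
  | succ k ih =>
    have hnk : (0 : ℝ) < (n : ℝ) - k := sub_pos.2 (by exact_mod_cast hk)
    calc levelEntropy φ μ (k + 1) f
        ≤ (1 - 1 / (C * (n - k))) * levelEntropy φ μ k f :=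
          h.levelEntropy_succ_le hφ hμ.1 hC hf hk
      _ ≤ ((n - k : ℝ) / ((n - k : ℝ) + 1)) ^ (1 / (C + 1)) * levelEntropy φ μ k f :=
          mul_le_mul_of_nonneg_right (one_sub_le_rpow hnk hC) (levelEntropy_nonneg hφ hμ hf)
      _ ≤ ((n - k : ℝ) / ((n - k : ℝ) + 1)) ^ (1 / (C + 1)) * (rate n k C * entropy φ μ f) :=
          mul_le_mul_of_nonneg_left (ih (Nat.le_of_succ_le hk)) (by positivity)
      _ = rate n (k + 1) C * entropy φ μ f := by rw [rate_succ hk, mul_assoc]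

theorem Tensorizes.subsingleton_support (h : Tensorizes φ s μ C) (hφ : StrictConvexOn ℝ s φ)
    (hs : Set.Ici 0 ⊆ s) (hμ : μ ∈ stdSimplex ℝ (∀ i, Ω i)) (hC₀ : 0 ≤ C) (hC : C < 1) :
    (Function.support μ).Subsingleton := by
  intro x hx y hy
  funext i
  let f : (∀ i, Ω i) → ℝ := fun z => if z i = x i then 1 else 0
  have hf : ∀ z, f z ∈ s := fun z => hs (Set.mem_Ici.2 (ite_nonneg zero_le_one le_rfl))
  -- `f` depends on the coordinate `i` alone, so only the `i`-th term of the tensorization survives.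
  have other : ∀ j ≠ i, entropy φ μ f - entropy φ μ (resample μ {j} *ᵥ f) = 0 := fun j hj =>
    sub_eq_zero.2 <| entropy_congr_support φ fun z hz =>
      (resample_mulVec_eq_self hμ.1 hz fun w _ hw => by
        simp only [f, hw i (Finset.notMem_singleton.2 hj.symm)]).symm
  have hle := h f hf
  rw [Fintype.sum_eq_single i other] at hle
  have hpos := entropy_nonneg hφ.convexOn hμ hf
  have hRpos := entropy_nonneg hφ.convexOn hμ
    (mulVec_mem hφ.1 (resample_mem_rowStochastic hμ.1 {i}) hf)
  have hzero : entropy φ μ f = 0 := by nlinarith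
  have hconst := (entropy_eq_zero_iff hφ hμ hf).1 hzero
  have hyx : f y = f x := (hconst hy).trans (hconst hx).symm
  by_contra hne
  simp [f, Ne.symm hne] at hyx

theorem Tensorizes.levelEntropy_le_one_sub (h : Tensorizes φ s μ C) (hφ : StrictConvexOn ℝ s φ)
    (hs : Set.Ici 0 ⊆ s) (hμ : μ ∈ stdSimplex ℝ (∀ i, Ω i)) (hC : 0 < C) (hf : ∀ x, f x ∈ s)
    (hk₁ : 1 ≤ k) (hk : k ≤ n) :
    levelEntropy φ μ k f ≤ (1 - 1 / 4 * (k / (C * n))) * entropy φ μ f := by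
  have hrate := h.levelEntropy_le_rate hφ.convexOn hμ hC hf hk
  rcases lt_or_ge C 1 with hC₁ | hC₁
  · have hzero := entropy_eq_zero_of_subsingleton_support φ hμ
      (h.subsingleton_support hφ hs hμ hC.le hC₁) f
    rwa [hzero, mul_zero] at hrate ⊢
  · exact hrate.trans (mul_le_mul_of_nonneg_right (rate_le_of_one_le hk₁ hk hC₁)
      (entropy_nonneg hφ.convexOn hμ hf))

theorem Tensorizes.contracts_glauber_rate (h : Tensorizes φ s μ C) (hφ : ConvexOn ℝ s φ)
    (hs : Set.Ici 0 ⊆ s) (hφ₁ : φ 1 = 0) (hμ : μ ∈ stdSimplex ℝ (∀ i, Ω i)) (hC : 0 < C)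
    (hk : k ≤ n) : Contracts φ μ (glauber μ k) (rate n k C) :=
  contracts_glauber hφ hs hφ₁ hμ.1 hk fun _ hf => h.levelEntropy_le_rate hφ hμ hC hf hk

theorem Tensorizes.contracts_glauber_one_sub (h : Tensorizes φ s μ C) (hφ : StrictConvexOn ℝ s φ)
    (hs : Set.Ici 0 ⊆ s) (hφ₁ : φ 1 = 0) (hμ : μ ∈ stdSimplex ℝ (∀ i, Ω i)) (hC : 0 < C)
    (hk₁ : 1 ≤ k) (hk : k ≤ n) :
    Contracts φ μ (glauber μ k) (1 - 1 / 4 * (k / (C * n))) :=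
  contracts_glauber hφ.convexOn hs hφ₁ hμ.1 hk fun _ hf =>
    h.levelEntropy_le_one_sub hφ hs hμ hC hf hk₁ hk

/-- The KL entropy is homogeneous, so it suffices to tensorize it for densities. -/
theorem tensorizes_klFun_of_forall_dotProduct_eq_one (hμ : ∀ x, 0 ≤ μ x) (hC : 0 ≤ C)
    (h : ∀ f : (∀ i, Ω i) → ℝ, (∀ x, 0 ≤ f x) → μ ⬝ᵥ f = 1 →
      entropy klFun μ f ≤ C * ∑ i, (entropy klFun μ f - entropy klFun μ (resample μ {i} *ᵥ f))) :
    Tensorizes klFun (Set.Ici 0) μ C := by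
  intro f hf
  have hm : 0 ≤ μ ⬝ᵥ f := Finset.sum_nonneg fun x _ => mul_nonneg (hμ x) (hf x)
  rcases hm.eq_or_lt' with hm | hm
  · have hf₀ : Set.EqOn f ((0 : ℝ) • f) (Function.support μ) := fun x hx => by
      have hx₀ := (Finset.sum_eq_zero_iff_of_nonneg fun x _ => mul_nonneg (hμ x) (hf x)).1 hm x
        (Finset.mem_univ x)
      rw [Pi.smul_apply, zero_smul, (mul_eq_zero.1 hx₀).resolve_left hx]
    have hzero : entropy klFun μ f = 0 := by
      rw [entropy_congr_support klFun hf₀, entropy_klFun_smul, zero_mul]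
    refine hzero.trans_le (mul_nonneg hC (Finset.sum_nonneg fun i _ => sub_nonneg.2 ?_))
    exact (isReversible_resample hμ {i}).entropy_mulVec_le (resample_mem_rowStochastic hμ {i}) hμ
      strictConvexOn_klFun.convexOn hf
  · set g : (∀ i, Ω i) → ℝ := (μ ⬝ᵥ f)⁻¹ • f with hg
    have hfg : f = (μ ⬝ᵥ f) • g := by rw [hg, smul_inv_smul₀ hm.ne']
    have hgm : μ ⬝ᵥ g = 1 := by rw [hg, dotProduct_smul, smul_eq_mul, inv_mul_cancel₀ hm.ne']
    have hle := mul_le_mul_of_nonneg_left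
      (h g (fun x => mul_nonneg (inv_nonneg.2 hm.le) (hf x)) hgm) hm.le
    rw [hfg]
    simp only [Matrix.mulVec_smul, entropy_klFun_smul, ← mul_sub, ← Finset.mul_sum]
    rwa [mul_left_comm]

end Tensorizes

section SecondEigenvalue

variable {A : Type u} [Fintype A] [DecidableEq A] {H : Matrix A A ℝ} {r : ℝ}

theorem exists_sq_add_sq_pos_mul_add_mul_eq_zero (a b : ℝ) :
    ∃ s t : ℝ, 0 < s ^ 2 + t ^ 2 ∧ s * a + t * b = 0 := by
  by_cases h : a = 0
  · exact ⟨1, 0, by norm_num, by simp [h]⟩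
  · exact ⟨b, -a, by rw [neg_sq]; positivity, by ring⟩

theorem eigenvectorBasis_dotProduct (hH : H.IsHermitian) (i j : A) :
    (⇑(hH.eigenvectorBasis i) : A → ℝ) ⬝ᵥ ⇑(hH.eigenvectorBasis j) = if i = j then 1 else 0 := by
  have h := orthonormal_iff_ite.1 hH.eigenvectorBasis.orthonormal j i
  rw [EuclideanSpace.inner_eq_star_dotProduct] at h
  simpa only [star_trivial, eq_comm] using h

/-- A form of the min-max principle: a plane spanned by two eigenvectors meets every hyperplane. -/
theorem eigenvalues_le_of_forall_dotProduct_eq_zero (hH : H.IsHermitian) {i j : A} (hij : i ≠ j)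
    (hle : hH.eigenvalues j ≤ hH.eigenvalues i) (w : A → ℝ)
    (h : ∀ v : A → ℝ, v ⬝ᵥ w = 0 → v ⬝ᵥ (H *ᵥ v) ≤ r * (v ⬝ᵥ v)) : hH.eigenvalues j ≤ r := by
  set p : A → ℝ := ⇑(hH.eigenvectorBasis i)
  set q : A → ℝ := ⇑(hH.eigenvectorBasis j)
  have hp : H *ᵥ p = hH.eigenvalues i • p := hH.mulVec_eigenvectorBasis i
  have hq : H *ᵥ q = hH.eigenvalues j • q := hH.mulVec_eigenvectorBasis j
  have hpp : p ⬝ᵥ p = 1 := by rw [eigenvectorBasis_dotProduct, if_pos rfl]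
  have hqq : q ⬝ᵥ q = 1 := by rw [eigenvectorBasis_dotProduct, if_pos rfl]
  have hpq : p ⬝ᵥ q = 0 := by rw [eigenvectorBasis_dotProduct, if_neg hij]
  have hqp : q ⬝ᵥ p = 0 := by rw [dotProduct_comm, hpq]
  obtain ⟨s, t, hst, hw⟩ := exists_sq_add_sq_pos_mul_add_mul_eq_zero (p ⬝ᵥ w) (q ⬝ᵥ w)
  have hv := h (s • p + t • q) (by simpa [add_dotProduct, smul_dotProduct] using hw)
  simp only [Matrix.mulVec_add, Matrix.mulVec_smul, hp, hq, add_dotProduct, dotProduct_add,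
    smul_dotProduct, dotProduct_smul, hpp, hqq, hpq, hqp, smul_eq_mul] at hv
  have hmul : hH.eigenvalues j * s ^ 2 ≤ hH.eigenvalues i * s ^ 2 :=
    mul_le_mul_of_nonneg_right hle (sq_nonneg s)
  refine le_of_mul_le_mul_right ?_ hst
  linarith

theorem eigenvaluesDesc_eq_ofFn (hH : H.IsHermitian) :
    eigenvaluesDesc H = List.ofFn hH.eigenvalues₀ := by
  simpa [eigenvaluesDesc] using hH.sort_roots_charpoly_eq_eigenvalues₀

theorem eigenvaluesDesc_getD_one_le (hH : H.IsHermitian) (hr : 0 ≤ r) (w : A → ℝ)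
    (h : ∀ v : A → ℝ, v ⬝ᵥ w = 0 → v ⬝ᵥ (H *ᵥ v) ≤ r * (v ⬝ᵥ v)) :
    (eigenvaluesDesc H).getD 1 0 ≤ r := by
  rw [eigenvaluesDesc_eq_ofFn hH]
  rcases le_or_gt (Fintype.card A) 1 with hcard | hcard
  · rwa [List.getD_eq_default _ _ (by rwa [List.length_ofFn])]
  rw [List.getD_eq_getElem _ _ (by rwa [List.length_ofFn]), List.getElem_ofFn]
  let e : Fin (Fintype.card A) ≃ A := Fintype.equivOfCardEq (Fintype.card_fin _)
  have he (i : Fin (Fintype.card A)) : hH.eigenvalues (e i) = hH.eigenvalues₀ i :=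
    congrArg hH.eigenvalues₀ (e.symm_apply_apply i)
  rw [← he]
  have hlt : (⟨0, zero_lt_one.trans hcard⟩ : Fin (Fintype.card A)) < ⟨1, hcard⟩ :=
    Fin.mk_lt_mk.2 zero_lt_one
  refine eigenvalues_le_of_forall_dotProduct_eq_zero hH (e.injective.ne hlt.ne) ?_ w h
  rw [he, he]
  exact hH.eigenvalues₀_antitone hlt.le

end SecondEigenvalue

section Symmetrization

variable {A : Type u} {μ : A → ℝ} {P : Matrix A A ℝ}

/-- The conjugate `D^{1/2} P D^{-1/2}` of the chain `P` on the support of `μ`, where `D` is the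
diagonal matrix of `μ`. It is symmetric when `P` is reversible. -/
def symmetrized (μ : A → ℝ) (P : Matrix A A ℝ) : Matrix {x // 0 < μ x} {x // 0 < μ x} ℝ :=
  Matrix.of fun x y => √(μ x) * P x y * (√(μ y))⁻¹

theorem charpoly_symmetrized [Fintype A] [DecidableEq A] (μ : A → ℝ) (P : Matrix A A ℝ) :
    (symmetrized μ P).charpoly = (onSupport μ P).charpoly := by
  have h (x : {x // 0 < μ x}) : (√(μ x))⁻¹ * √(μ x) = 1 :=
    inv_mul_cancel₀ (Real.sqrt_pos.2 x.2).ne'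
  have hconj : symmetrized μ P = Matrix.diagonal (fun x : {x // 0 < μ x} => √(μ x)) *
      onSupport μ P * Matrix.diagonal fun x : {x // 0 < μ x} => (√(μ x))⁻¹ := by
    ext x y
    rw [Matrix.mul_diagonal, Matrix.diagonal_mul]
    rfl
  rw [hconj, Matrix.charpoly_mul_comm, ← mul_assoc, Matrix.diagonal_mul_diagonal]
  simp only [h, Matrix.diagonal_one, one_mul]

theorem IsReversible.isHermitian_symmetrized (hP : IsReversible μ P) :
    (symmetrized μ P).IsHermitian := by
  refine Matrix.IsHermitian.ext fun x y => ?_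
  have hx : √(μ x) ≠ 0 := (Real.sqrt_pos.2 x.2).ne'
  have hy : √(μ y) ≠ 0 := (Real.sqrt_pos.2 y.2).ne'
  have hxy := hP x y
  rw [← Real.mul_self_sqrt x.2.le, ← Real.mul_self_sqrt y.2.le] at hxy
  simp only [symmetrized, Matrix.of_apply, star_trivial]
  field_simp
  linarith

/-- The function on the whole space whose restriction to the support of `μ` is `μ^{-1/2} v`. -/
def unsymmetrize (μ : A → ℝ) (v : {x // 0 < μ x} → ℝ) : A → ℝ :=
  Function.extend Subtype.val (fun x => (√(μ x))⁻¹ * v x) 0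

theorem unsymmetrize_apply (v : {x // 0 < μ x} → ℝ) (x : {x // 0 < μ x}) :
    unsymmetrize μ v x = (√(μ x))⁻¹ * v x :=
  Subtype.val_injective.extend_apply _ _ _

variable [Fintype A]

theorem sum_eq_sum_subtype {p : A → Prop} [Fintype {x // p x}] {g : A → ℝ}
    (hg : ∀ x, ¬ p x → g x = 0) : ∑ x, g x = ∑ x : {x // p x}, g x :=
  (Fintype.sum_of_injective Subtype.val Subtype.val_injective _ g
    (fun x hx => hg x fun h => hx ⟨⟨x, h⟩, rfl⟩) fun _ => rfl).symm

theorem dotProduct_eq_sum_support (hμ : ∀ x, 0 ≤ μ x) (g : A → ℝ) :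
    μ ⬝ᵥ g = ∑ x : {x // 0 < μ x}, √(μ x) * √(μ x) * g x := by
  simp only [Real.mul_self_sqrt (hμ _)]
  exact sum_eq_sum_subtype fun x hx => by
    rw [(hμ x).antisymm' (not_lt.1 hx), zero_mul]

theorem symmetrized_mulVec (P : Matrix A A ℝ) (v : {x // 0 < μ x} → ℝ) (x : {x // 0 < μ x}) :
    (symmetrized μ P *ᵥ v) x = √(μ x) * (P *ᵥ unsymmetrize μ v) x := by
  have h : (P *ᵥ unsymmetrize μ v) x = ∑ y : {x // 0 < μ x}, P x y * unsymmetrize μ v y :=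
    sum_eq_sum_subtype fun y hy => by
      rw [unsymmetrize, Function.extend_apply' _ _ _ fun ⟨z, hz⟩ => hy (hz ▸ z.2), Pi.zero_apply,
        mul_zero]
  rw [h, Finset.mul_sum]
  refine Finset.sum_congr rfl fun y _ => ?_
  simp only [symmetrized, Matrix.of_apply, unsymmetrize_apply]
  ring

theorem lambda2_le [DecidableEq A] {r : ℝ} (hP : IsReversible μ P) (hμ : ∀ x, 0 ≤ μ x)
    (hr : 0 ≤ r) (h : ∀ f : A → ℝ, μ ⬝ᵥ f = 0 → μ ⬝ᵥ (f * (P *ᵥ f)) ≤ r * (μ ⬝ᵥ (f * f))) :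
    lambda2 μ P ≤ r := by
  rw [lambda2, eigenvaluesDesc, ← charpoly_symmetrized]
  refine eigenvaluesDesc_getD_one_le hP.isHermitian_symmetrized hr (fun x => √(μ x))
    fun v hv => ?_
  let f := unsymmetrize μ v
  have hf (x : {x // 0 < μ x}) : v x = √(μ x) * f x := by
    simp only [f, unsymmetrize_apply, mul_inv_cancel_left₀ (Real.sqrt_pos.2 x.2).ne']
  have hmean : μ ⬝ᵥ f = 0 := by
    refine (dotProduct_eq_sum_support hμ f).trans (Eq.trans (Finset.sum_congr rfl fun x _ => ?_) hv)
    rw [hf]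
    ring
  have hnorm : v ⬝ᵥ v = μ ⬝ᵥ (f * f) := by
    rw [dotProduct_eq_sum_support hμ]
    refine Finset.sum_congr rfl fun x _ => ?_
    rw [hf, Pi.mul_apply]
    ring
  have hform : v ⬝ᵥ (symmetrized μ P *ᵥ v) = μ ⬝ᵥ (f * (P *ᵥ f)) := by
    rw [dotProduct_eq_sum_support hμ]
    refine Finset.sum_congr rfl fun x _ => ?_
    rw [symmetrized_mulVec, hf, Pi.mul_apply]
    ring
  rw [hform, hnorm]
  exact h f hmean

end Symmetrization

section Poincare

variable {n k : ℕ} {Ω : Fin n → Type u} [∀ i, Fintype (Ω i)] [∀ i, DecidableEq (Ω i)]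
  {μ : (∀ i, Ω i) → ℝ} {C : ℝ} {f : (∀ i, Ω i) → ℝ}

theorem entropy_chiSqFun_resample (hμ : μ ∈ stdSimplex ℝ (∀ i, Ω i)) (S : Finset (Fin n))
    (f : (∀ i, Ω i) → ℝ) :
    entropy chiSqFun μ (resample μ S *ᵥ f) =
      μ ⬝ᵥ (f * (resample μ S *ᵥ f)) - (μ ⬝ᵥ f) ^ 2 := by
  rw [entropy_chiSqFun hμ, dotProduct_mul_resample_mulVec hμ.1,
    (isReversible_resample hμ.1 S).dotProduct_mulVec (resample_mem_rowStochastic hμ.1 S)]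

theorem levelEntropy_chiSqFun (hμ : μ ∈ stdSimplex ℝ (∀ i, Ω i)) (hk : k ≤ n)
    (f : (∀ i, Ω i) → ℝ) :
    levelEntropy chiSqFun μ k f = μ ⬝ᵥ (f * (glauber μ k *ᵥ f)) - (μ ⬝ᵥ f) ^ 2 := by
  have h : f * (glauber μ k *ᵥ f) = fun x =>
      𝔼 S ∈ Finset.powersetCard k Finset.univ, (f * (resample μ S *ᵥ f)) x := by
    funext x
    simp only [Pi.mul_apply, glauber_mulVec, Finset.mul_expect]
  rw [h, dotProduct_expect, levelEntropy]
  simp only [entropy_chiSqFun_resample hμ, Finset.expect_sub_distrib,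
    Finset.expect_const (powersetCard_univ_nonempty hk)]

theorem dirichletForm_glauber (hμ : μ ∈ stdSimplex ℝ (∀ i, Ω i)) (hk : k ≤ n)
    (f : (∀ i, Ω i) → ℝ) :
    dirichletForm μ (glauber μ k) f f = entropy chiSqFun μ f - levelEntropy chiSqFun μ k f := by
  have h : dirichletForm μ (glauber μ k) f f = μ ⬝ᵥ (f * (f - glauber μ k *ᵥ f)) := rfl
  rw [h, mul_sub, dotProduct_sub, entropy_chiSqFun hμ, levelEntropy_chiSqFun hμ hk,
    sub_sub_sub_cancel_right]

theorem levelEntropy_one (φ : ℝ → ℝ) (μ f : (∀ i, Ω i) → ℝ) :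
    levelEntropy φ μ 1 f = (∑ i, entropy φ μ (resample μ {i} *ᵥ f)) / n := by
  rw [levelEntropy, Finset.powersetCard_one, Finset.expect_eq_sum_div_card, Finset.sum_map,
    Finset.card_map, Finset.card_fin]
  rfl

theorem Poincare.tensorizes (h : Poincare μ (glauber μ 1) (C * n))
    (hμ : μ ∈ stdSimplex ℝ (∀ i, Ω i)) (hn : 1 ≤ n) : Tensorizes chiSqFun Set.univ μ C := by
  intro f _
  have hn₀ : (n : ℝ) ≠ 0 := by exact_mod_cast (Nat.one_le_iff_ne_zero.1 hn)
  have hf := h f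
  rw [← entropy_chiSqFun_eq_variance hμ, dirichletForm_glauber hμ hn, levelEntropy_one] at hf
  refine hf.trans_eq ?_
  rw [Finset.sum_sub_distrib, Finset.sum_const, Finset.card_fin, nsmul_eq_mul]
  field_simp

theorem Tensorizes.poincare_glauber (h : Tensorizes chiSqFun Set.univ μ C)
    (hμ : μ ∈ stdSimplex ℝ (∀ i, Ω i)) (hC : 0 < C) (hk₁ : 1 ≤ k) (hk : k ≤ n) :
    Poincare μ (glauber μ k) (4 * (C * n / k)) := by
  intro f
  have : (0 : ℝ) < k := by exact_mod_cast hk₁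
  have : (0 : ℝ) < n := by exact_mod_cast hk₁.trans hk
  have hle := h.levelEntropy_le_one_sub strictConvexOn_chiSqFun (Set.subset_univ _) hμ hC
    (fun _ => Set.mem_univ _) hk₁ hk (f := f)
  have hgap : 1 / 4 * (k / (C * n)) * entropy chiSqFun μ f ≤
      dirichletForm μ (glauber μ k) f f := by
    rw [dirichletForm_glauber hμ hk]
    linarith
  rw [← entropy_chiSqFun_eq_variance hμ]
  calc entropy chiSqFun μ f
      = 4 * (C * n / k) * (1 / 4 * (k / (C * n)) * entropy chiSqFun μ f) := by field_simp
    _ ≤ 4 * (C * n / k) * dirichletForm μ (glauber μ k) f f := by gcongr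

theorem Tensorizes.dotProduct_mul_glauber_mulVec_le (h : Tensorizes chiSqFun Set.univ μ C)
    (hμ : μ ∈ stdSimplex ℝ (∀ i, Ω i)) (hC : 0 < C) (hk : k ≤ n) (hf : μ ⬝ᵥ f = 0) :
    μ ⬝ᵥ (f * (glauber μ k *ᵥ f)) ≤ rate n k C * (μ ⬝ᵥ (f * f)) := by
  have hle := h.levelEntropy_le_rate strictConvexOn_chiSqFun.convexOn hμ hC
    (fun _ => Set.mem_univ _) hk (f := f)
  simpa only [levelEntropy_chiSqFun hμ hk, entropy_chiSqFun hμ, hf, ne_eq, OfNat.ofNat_ne_zero,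
    not_false_eq_true, zero_pow, sub_zero] using hle

theorem Tensorizes.lambda2_glauber_le (h : Tensorizes chiSqFun Set.univ μ C)
    (hμ : μ ∈ stdSimplex ℝ (∀ i, Ω i)) (hC : 0 < C) (hk : k ≤ n) :
    lambda2 μ (glauber μ k) ≤ rate n k C :=
  lambda2_le (isReversible_glauber hμ.1 k) hμ.1 (rate_nonneg hk C) fun _ hf =>
    h.dotProduct_mul_glauber_mulVec_le hμ hC hk hf

end Poincare

section Homogenization

variable {n : ℕ} {Ω : Fin n → Type u} [∀ i, DecidableEq (Ω i)]

theorem mem_graphSet {σ : ∀ i, Ω i} {a : Σ i, Ω i} : a ∈ graphSet σ ↔ σ a.1 = a.2 := by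
  obtain ⟨i, b⟩ := a
  simp only [graphSet, Finset.mem_image, Finset.mem_univ, true_and]
  constructor
  · rintro ⟨j, hj⟩
    cases hj
    rfl
  · rintro rfl
    exact ⟨i, rfl⟩

theorem card_graphSet (σ : ∀ i, Ω i) : (graphSet σ).card = n := by
  rw [graphSet, Finset.card_image_of_injective _ fun _ _ h => congrArg Sigma.fst h,
    Finset.card_fin]

theorem graphSet_injective : Function.Injective (graphSet (Ω := Ω)) := fun σ τ h =>
  funext fun i => mem_graphSet.1 (h ▸ mem_graphSet.2 rfl : (⟨i, τ i⟩ : Σ i, Ω i) ∈ graphSet σ)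

/-- `graphSet` as a map to the `n`-element sets. -/
def graphSlice (σ : ∀ i, Ω i) : Slice (Σ i, Ω i) n := ⟨graphSet σ, card_graphSet σ⟩

theorem graphSlice_injective : Function.Injective (graphSlice (Ω := Ω)) := fun _ _ h =>
  graphSet_injective (congrArg Subtype.val h)

/-- The graph of `σ` with the element over `i` removed. -/
def eraseSlice (σ : ∀ i, Ω i) (i : Fin n) : Slice (Σ i, Ω i) (n - 1) :=
  ⟨(graphSet σ).erase ⟨i, σ i⟩, by
    rw [Finset.card_erase_of_mem (mem_graphSet.2 rfl), card_graphSet]⟩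

theorem eraseSlice_injective (σ : ∀ i, Ω i) : Function.Injective (eraseSlice σ) := by
  intro i j hij
  have herase : (graphSet σ).erase ⟨i, σ i⟩ = (graphSet σ).erase ⟨j, σ j⟩ :=
    congrArg Subtype.val hij
  exact congrArg Sigma.fst (Finset.erase_injOn _ (mem_graphSet.2 rfl) (mem_graphSet.2 rfl) herase)

theorem eraseSlice_subset_graphSet {σ τ : ∀ i, Ω i} {i : Fin n} :
    (eraseSlice σ i).1 ⊆ graphSet τ ↔ ∀ j, j ∉ ({i} : Finset (Fin n)) → τ j = σ j := by
  constructor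
  · intro h j hj
    refine (mem_graphSet (a := ⟨j, σ j⟩)).1
      (h (Finset.mem_erase.2 ⟨fun hji => hj ?_, mem_graphSet.2 rfl⟩))
    exact Finset.mem_singleton.2 (congrArg Sigma.fst hji)
  · rintro h ⟨j, b⟩ hjb
    obtain ⟨hne, hmem⟩ := Finset.mem_erase.1 hjb
    obtain rfl : σ j = b := mem_graphSet.1 hmem
    refine mem_graphSet.2 (h j fun hj => hne ?_)
    rw [Finset.mem_singleton.1 hj]

theorem mem_range_eraseSlice {σ : ∀ i, Ω i} {B : Slice (Σ i, Ω i) (n - 1)} (hn : 1 ≤ n)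
    (hB : B.1 ⊆ graphSet σ) : B ∈ Set.range (eraseSlice σ) := by
  obtain ⟨⟨i, b⟩, hiB, hins⟩ := Finset.exists_eq_insert_iff.2
    ⟨hB, by rw [B.2, card_graphSet, Nat.sub_add_cancel hn]⟩
  obtain rfl : σ i = b := mem_graphSet.1 (hins ▸ Finset.mem_insert_self _ _)
  refine ⟨i, Subtype.ext ?_⟩
  change (graphSet σ).erase ⟨i, σ i⟩ = B.1
  rw [← hins, Finset.erase_insert hiB]

theorem down_graphSlice (hn : 1 ≤ n) (σ : ∀ i, Ω i) (B : Slice (Σ i, Ω i) (n - 1)) :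
    down (Σ i, Ω i) n (n - 1) (graphSlice σ) B = if B.1 ⊆ graphSet σ then 1 / (n : ℝ) else 0 := by
  simp only [down, Matrix.of_apply, graphSlice, Nat.choose_symm hn, Nat.choose_one_right]

variable [∀ i, Fintype (Ω i)]

theorem homogenization_graphSlice (ν : (∀ i, Ω i) → ℝ) (σ : ∀ i, Ω i) :
    homogenization ν (graphSlice σ) = ν σ := by
  simp only [homogenization, graphSlice, graphSet_injective.eq_iff, Finset.sum_ite_eq',
    Finset.mem_univ, if_true]

theorem homogenization_of_notMem_range (ν : (∀ i, Ω i) → ℝ) {A : Slice (Σ i, Ω i) n}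
    (hA : A ∉ Set.range graphSlice) : homogenization ν A = 0 :=
  Finset.sum_eq_zero fun σ _ => if_neg fun h => hA ⟨σ, Subtype.ext h⟩

theorem homogenization_dotProduct (ν : (∀ i, Ω i) → ℝ) (G : Slice (Σ i, Ω i) n → ℝ) :
    homogenization ν ⬝ᵥ G = ν ⬝ᵥ (G ∘ graphSlice) :=
  (Fintype.sum_of_injective graphSlice graphSlice_injective _ _
    (fun A hA => by rw [homogenization_of_notMem_range ν hA, zero_mul])
    fun σ => by rw [homogenization_graphSlice, Function.comp_apply]).symm

theorem homogenization_mem_stdSimplex {ν : (∀ i, Ω i) → ℝ} (hν : ν ∈ stdSimplex ℝ (∀ i, Ω i)) :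
    homogenization ν ∈ stdSimplex ℝ (Slice (Σ i, Ω i) n) := by
  refine ⟨fun A => Finset.sum_nonneg fun σ _ => ite_nonneg (hν.1 σ) le_rfl, ?_⟩
  rw [← dotProduct_one, homogenization_dotProduct]
  exact (dotProduct_one ν).trans hν.2

theorem homogenization_eq_zero {μ ν : (∀ i, Ω i) → ℝ} (h : ∀ σ, μ σ = 0 → ν σ = 0)
    {A : Slice (Σ i, Ω i) n} (hA : homogenization μ A = 0) : homogenization ν A = 0 := by
  by_cases hrange : A ∈ Set.range graphSlice
  · obtain ⟨σ, rfl⟩ := hrange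
    rw [homogenization_graphSlice] at hA ⊢
    exact h σ hA
  · exact homogenization_of_notMem_range ν hrange

theorem divergence_homogenization (φ : ℝ → ℝ) (ν μ : (∀ i, Ω i) → ℝ) :
    divergence φ (homogenization ν) (homogenization μ) = divergence φ ν μ := by
  refine (homogenization_dotProduct μ _).trans (Finset.sum_congr rfl fun σ _ => ?_)
  simp only [Function.comp_apply, homogenization_graphSlice]

theorem down_mulVec_graphSlice (hn : 1 ≤ n) (σ : ∀ i, Ω i)
    (G : Slice (Σ i, Ω i) (n - 1) → ℝ) :
    (down (Σ i, Ω i) n (n - 1) *ᵥ G) (graphSlice σ) = (∑ i, G (eraseSlice σ i)) / n := by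
  simp only [Matrix.mulVec, dotProduct, down_graphSlice hn, ite_mul, zero_mul, Finset.sum_div]
  refine (Fintype.sum_of_injective (eraseSlice σ) (eraseSlice_injective σ) _ _
    (fun B hB => ?_) fun i => ?_).symm
  · rw [if_neg fun h => hB (mem_range_eraseSlice hn h)]
  · have h : (eraseSlice σ i).1 ⊆ graphSet σ := Finset.erase_subset _ _
    rw [if_pos h, one_div_mul_eq_div]

theorem homogenization_vecMul_down_eraseSlice (hn : 1 ≤ n) (ν : (∀ i, Ω i) → ℝ) (σ : ∀ i, Ω i)
    (i : Fin n) :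
    (homogenization ν ᵥ* down (Σ i, Ω i) n (n - 1)) (eraseSlice σ i) =
      marginalOff ν {i} σ / n := by
  refine (homogenization_dotProduct ν _).trans ?_
  rw [marginalOff, Finset.sum_div]
  refine Finset.sum_congr rfl fun τ _ => ?_
  simp only [Function.comp_apply, down_graphSlice hn, eraseSlice_subset_graphSet, mul_ite,
    mul_one_div, mul_zero, ite_div, zero_div]

theorem divergence_homogenization_vecMul_down (hn : 1 ≤ n) (φ : ℝ → ℝ) {μ : (∀ i, Ω i) → ℝ}
    (hμ : ∀ σ, 0 ≤ μ σ) (f : (∀ i, Ω i) → ℝ) :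
    divergence φ (homogenization (μ * f) ᵥ* down (Σ i, Ω i) n (n - 1))
        (homogenization μ ᵥ* down (Σ i, Ω i) n (n - 1)) =
      (∑ i, μ ⬝ᵥ (φ ∘ (resample μ {i} *ᵥ f))) / n := by
  have hn₀ : (n : ℝ) ≠ 0 := by exact_mod_cast (Nat.one_le_iff_ne_zero.1 hn)
  refine (Matrix.dotProduct_mulVec _ _ _).symm.trans ?_
  rw [homogenization_dotProduct, ← dotProduct_sum, dotProduct, dotProduct, Finset.sum_div]
  refine Finset.sum_congr rfl fun σ _ => ?_
  by_cases hσ : μ σ = 0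
  · simp only [hσ, zero_mul, zero_div]
  · rw [Function.comp_apply, down_mulVec_graphSlice hn, mul_div_assoc, Finset.sum_apply]
    simp only [homogenization_vecMul_down_eraseSlice hn, div_div_div_cancel_right₀ hn₀,
      Function.comp_apply, resample_mulVec hμ _ hσ]

theorem ApproxTensorization.tensorizes {μ : (∀ i, Ω i) → ℝ} {C : ℝ}
    (h : ApproxTensorization μ C) (hμ : μ ∈ stdSimplex ℝ (∀ i, Ω i)) (hC : 0 < C) (hn : 1 ≤ n) :
    Tensorizes klFun (Set.Ici 0) μ C := by
  refine tensorizes_klFun_of_forall_dotProduct_eq_one hμ.1 hC.le fun f hf hmean => ?_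
  have hn₀ : (0 : ℝ) < n := by exact_mod_cast hn
  have hR (i : Fin n) : entropy klFun μ (resample μ {i} *ᵥ f) =
      μ ⬝ᵥ (klFun ∘ (resample μ {i} *ᵥ f)) := by
    rw [entropy, (isReversible_resample hμ.1 {i}).dotProduct_mulVec
      (resample_mem_rowStochastic hμ.1 {i}), hmean, klFun_one, sub_zero]
  have hcontr := h (homogenization (μ * f))
    (homogenization_mem_stdSimplex ⟨fun σ => mul_nonneg (hμ.1 σ) (hf σ), hmean⟩)
    fun A hA => homogenization_eq_zero (fun σ hσ => by rw [Pi.mul_apply, hσ, zero_mul]) hA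
  rw [divergence_homogenization_vecMul_down hn _ hμ.1, divergence_homogenization,
    divergence_mul_eq_entropy klFun_one hmean, div_le_iff₀ hn₀] at hcontr
  simp only [← hR] at hcontr
  rw [Finset.sum_sub_distrib, Finset.sum_const, Finset.card_fin, nsmul_eq_mul]
  have hid : (1 - 1 / (C * n)) * entropy klFun μ f * n =
      n * entropy klFun μ f - entropy klFun μ f / C := by field_simp
  rw [hid, le_sub_comm, div_le_iff₀' hC] at hcontr
  exact hcontr

end Homogenization

end KGlauber

end

theorem theoremt :
    ∃ c > (0 : ℝ), ∃ K > (0 : ℝ),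
      ∀ (n k : ℕ) (_ : 1 ≤ k) (_ : k ≤ n) (C : ℝ) (_ : 0 < C),
        KGlauber.rate n k C ≤ 1 - c * (k / ((C + 1) * n)) ∧
        ∀ (Ω : Fin n → Type*) [∀ i, Fintype (Ω i)] [∀ i, DecidableEq (Ω i)]
          (μ : (∀ i, Ω i) → ℝ) (_ : μ ∈ stdSimplex ℝ (∀ i, Ω i)),
          (KGlauber.Poincare μ (KGlauber.glauber μ 1) (C * n) →
            (1 < Fintype.card {x // 0 < μ x} →
              KGlauber.lambda2 μ (KGlauber.glauber μ k) ≤ KGlauber.rate n k C) ∧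
            KGlauber.Poincare μ (KGlauber.glauber μ k) (K * (C * n / k)) ∧
            KGlauber.Contracts KGlauber.chiSqFun μ (KGlauber.glauber μ k)
              (1 - c * (k / (C * n)))) ∧
          (KGlauber.ApproxTensorization μ C →
            KGlauber.Contracts KGlauber.klFun μ (KGlauber.glauber μ k) (KGlauber.rate n k C) ∧
            KGlauber.Contracts KGlauber.klFun μ (KGlauber.glauber μ k)
              (1 - c * (k / (C * n)))) := by
  refine ⟨1 / 4, by norm_num, 4, by norm_num, fun n k hk₁ hk C hC => ⟨?_, ?_⟩⟩
  · have hgap : 0 ≤ k / ((C + 1) * n) := by positivity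
    linarith [KGlauber.rate_le hk₁ hk hC.le]
  intro Ω _ _ μ hμ
  have hn : 1 ≤ n := hk₁.trans hk
  constructor
  · intro hpoincare
    have h : KGlauber.Tensorizes KGlauber.chiSqFun Set.univ μ C := hpoincare.tensorizes hμ hn
    exact ⟨fun _ => h.lambda2_glauber_le hμ hC hk, h.poincare_glauber hμ hC hk₁ hk,
      h.contracts_glauber_one_sub KGlauber.strictConvexOn_chiSqFun (Set.subset_univ _)
        KGlauber.chiSqFun_one hμ hC hk₁ hk⟩
  · intro happrox
    have h : KGlauber.Tensorizes KGlauber.klFun (Set.Ici 0) μ C := happrox.tensorizes hμ hC hn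
    have hφ := KGlauber.strictConvexOn_klFun
    exact ⟨h.contracts_glauber_rate hφ.convexOn subset_rfl KGlauber.klFun_one hμ hC hk,
      h.contracts_glauber_one_sub hφ subset_rfl KGlauber.klFun_one hμ hC hk₁ hk⟩
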